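/- Let $\mathcal G=(I,E)$ be a finite directed acyclic graph with $m=|I|$, and let $c\colon I\cup E\to\mathcal C$ be a colouring of its vertices and edges; write $c(ij)$ for the colour of the edge $j\to i$ and $c(ii):=c(i)$. Assume that $c$ is compatible: no vertex has the same colour as an edge, and if edges $j\to i$ and $l\to k$ satisfy $c(ij)=c(kl)$, then $c(i)=c(k)$. The RDAG model on $(\mathcal G,c)$ is the set of matrices $\Psi=(\mathrm{id}-\Lambda)^{\mathsf T}\Omega^{-1}(\mathrm{id}-\Lambda)$, where $\Lambda\in\mathbb R^{m\times m}$ satisfies $\lambda_{ij}=0$ unless $j\to i$ and $\lambda_{ij}=\lambda_{kl}$ whenever the edges $j\to i$, $l\to k$ have the same colour, and $\Omega$ is diagonal with positive entries satisfying $\omega_{ii}=\omega_{jj}$ whenever $c(i)=c(j)$. Given $Y\in\mathbb R^{m\times n}$ with columns $Y_1,\dots,Y_n$, an MLE given $Y$ is a point $\Psi$ of the model that maximises over the model the likelihood $\prod_{k=1}^n \det(2\pi\Psi^{-1})^{-1/2}\exp(-\tfrac12 Y_k^{\mathsf T}\Psi Y_k)$. Let $A(\mathcal G,c)$ be the set of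 invertible real $m\times m$ matrices $a$ with $a_{ij}=0$ whenever $i\ne j$ and $j\not\to i$, and $a_{ij}=a_{kl}$ whenever $c(ij)=c(kl)$ (for vertices as well as edges). Assume that $A(\mathcal G,c)$ is a group under matrix multiplication, and put $A:=A(\mathcal G,c)_{\mathrm{SL}}=\{a\in A(\mathcal G,c): \det a=1\}$ and $A_Y:=\{g\in A: gY=Y\}$. Let $Y\in\mathbb R^{m\times n}$ be polystable under $A$, that is, $Y\neq0$ and $\{aY: a\in A\}$ is closed in $\mathbb R^{m\times n}$. If $\lambda a^{\mathsf T}a$ is an MLE given $Y$, where $a\in A$ and $\lambda>0$, then $$\varphi\colon A_Y\to\{\text{MLEs given }Y\},\qquad g\mapsto \lambda\, g^{\mathsf T}a^{\mathsf T}a\,g,$$ is well defined and is a bijection. -/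

import Mathlib

open scoped Matrix

noncomputable section

/-- A coloured DAG `(𝒢, c)` on the vertex set `V` with colours in `C`: an acyclic directed graph
(`graph.Adj j i` is the edge `j → i`) together with a map `c : I ∪ E → C` giving a colour to every
vertex and to every edge. An edge `j → i` is the pair `(j, i)`. -/
structure ColouredDAG (V : Type*) (C : Type*) where
  graph : Digraph V
  acyclic : ∀ i : V, ¬ Relation.TransGen graph.Adj i i
  colour : V ⊕ {e : V × V // graph.Adj e.1 e.2} → C

namespace ColouredDAG

variable {V : Type*} {C : Type*}

/-- The edges of the graph, as pairs (source, target). -/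
abbrev Edge (D : ColouredDAG V C) : Type _ := {e : V × V // D.graph.Adj e.1 e.2}

/-- The colour `c(i)` of a vertex. -/
def vertexColour (D : ColouredDAG V C) (i : V) : C := D.colour (Sum.inl i)

/-- The colour of an edge. For the edge `j → i` this is written `c(ij)`. -/
def edgeColour (D : ColouredDAG V C) (e : D.Edge) : C := D.colour (Sum.inr e)

/-- The position (row, column) of the matrix entry belonging to a vertex or to an edge: `(i, i)` for
the vertex `i`, and `(i, j)` for the edge `j → i`. -/
def position (D : ColouredDAG V C) : V ⊕ D.Edge → V × V
  | Sum.inl i => (i, i)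
  | Sum.inr e => (e.1.2, e.1.1)

/-- The colouring is compatible: (i) vertex colours and edge colours are disjoint; (ii) edges of the
same colour have targets (children) of the same colour. -/
def Compatible (D : ColouredDAG V C) : Prop :=
  (∀ (i : V) (e : D.Edge), D.vertexColour i ≠ D.edgeColour e) ∧
  (∀ e e' : D.Edge, D.edgeColour e = D.edgeColour e' →
    D.vertexColour e.1.2 = D.vertexColour e'.1.2)

variable [Fintype V] [DecidableEq V]

/-- The restricted DAG model: all concentration matrices `(1 - Λ)ᵀ Ω⁻¹ (1 - Λ)`, where `Λ` is
supported on the edges and constant on edges of the same colour, and `Ω` is diagonal with positive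
entries that agree on vertices of the same colour. -/
def model (D : ColouredDAG V C) : Set (Matrix V V ℝ) :=
  {Ψ | ∃ (Λ : Matrix V V ℝ) (ω : V → ℝ),
    (∀ i j, ¬ D.graph.Adj j i → Λ i j = 0) ∧
    (∀ e e' : D.Edge, D.edgeColour e = D.edgeColour e' → Λ e.1.2 e.1.1 = Λ e'.1.2 e'.1.1) ∧
    (∀ i, 0 < ω i) ∧
    (∀ i j, D.vertexColour i = D.vertexColour j → ω i = ω j) ∧
    Ψ = (1 - Λ)ᵀ * (Matrix.diagonal ω)⁻¹ * (1 - Λ)}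

/-- The set `A(𝒢, c)` of invertible matrices `a` with `a i j = 0` for `i ≠ j` unless `j → i`, and
whose entries agree at all positions (diagonal ones, coloured by the vertices, and those of the
edges) of the same colour. -/
def matrixSet (D : ColouredDAG V C) : Set (GL V ℝ) :=
  {a | (∀ i j, i ≠ j → ¬ D.graph.Adj j i → (a : Matrix V V ℝ) i j = 0) ∧
    (∀ x y : V ⊕ D.Edge, D.colour x = D.colour y →
      (a : Matrix V V ℝ) (D.position x).1 (D.position x).2 =
        (a : Matrix V V ℝ) (D.position y).1 (D.position y).2)}

end ColouredDAG

section Stability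

variable {V : Type*} [Fintype V] [DecidableEq V] {n : ℕ}

/-- A set of invertible matrices is a group (under matrix multiplication). -/
def IsMatrixGroup (A : Set (GL V ℝ)) : Prop := ∃ H : Subgroup (GL V ℝ), (H : Set (GL V ℝ)) = A

/-- The subset `A_SL` of matrices in `A` of determinant one. -/
def slPart (A : Set (GL V ℝ)) : Set (GL V ℝ) := {a ∈ A | (a : Matrix V V ℝ).det = 1}

/-- The orbit `A · Y` under a set of invertible matrices. -/
def setOrbit (A : Set (GL V ℝ)) (Y : Matrix V (Fin n) ℝ) : Set (Matrix V (Fin n) ℝ) :=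
  {Z | ∃ a ∈ A, Z = (a : Matrix V V ℝ) * Y}

/-- The stabiliser `A_Y` under a set of invertible matrices. -/
def setStabiliser (A : Set (GL V ℝ)) (Y : Matrix V (Fin n) ℝ) : Set (GL V ℝ) :=
  {a ∈ A | (a : Matrix V V ℝ) * Y = Y}

/-- `Y` is polystable under the set `A`: it is nonzero and its orbit is closed. -/
def IsPolystable (A : Set (GL V ℝ)) (Y : Matrix V (Fin n) ℝ) : Prop :=
  Y ≠ 0 ∧ IsClosed (setOrbit A Y)

end Stability

section Likelihood

variable {V : Type*} [Fintype V] [DecidableEq V] {n : ℕ}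

/-- The density at `y` of the centred Gaussian with concentration matrix `Ψ`. -/
def gaussianDensity (Ψ : Matrix V V ℝ) (y : V → ℝ) : ℝ :=
  1 / Real.sqrt (((2 * Real.pi) • Ψ⁻¹).det) * Real.exp (-(1 / 2) * (y ⬝ᵥ (Ψ *ᵥ y)))

/-- The likelihood of `Ψ` given the independent samples that are the columns of `Y`. -/
def likelihood (Y : Matrix V (Fin n) ℝ) (Ψ : Matrix V V ℝ) : ℝ :=
  ∏ k : Fin n, gaussianDensity Ψ (fun i => Y i k)

/-- The set of maximum likelihood estimates given `Y` in a model `M`: the points of `M` at which the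
likelihood attains its maximum over `M`. -/
def mleSet (M : Set (Matrix V V ℝ)) (Y : Matrix V (Fin n) ℝ) : Set (Matrix V V ℝ) :=
  {Ψ ∈ M | ∀ Ψ' ∈ M, likelihood Y Ψ' ≤ likelihood Y Ψ}

end Likelihood

end

/-! By compatibility the model is the set of `Mᵀ * M` with `M` in a linear space `coeffSpace`, and
`M` may be taken with positive diagonal. The likelihood there is a constant times `|M.det| ^ n * exp
(-‖M * Y‖² / 2)`, and acyclicity makes `M.det` the product of the diagonal. It is therefore
log-concave on a convex set, strictly so in `M * Y`: all maximisers share `M * Y` and then `M.det`,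
so the quotient of two factors lies in `A_Y`. This gives surjectivity.

For injectivity, `g` and `h` with equal images differ by an orthogonal `k` of the group with `a * g
= k * (a * h)`. Acyclicity makes `k` diagonal, and `k` fixes `a * Y`. If `k i i ≠ 1`, row `i` of `a
* Y` vanishes and could be scaled up, contradicting maximality. -/

open Matrix

/-! ### The coefficient space and factorisations of model points -/

namespace ColouredDAG

variable {V C : Type*} (D : ColouredDAG V C)

/-- The linear space of matrices supported on the diagonal and the edges whose entries agree at
positions of the same colour. -/
def coeffSpace : Submodule ℝ (Matrix V V ℝ) where
  carrier := {M | (∀ i j, i ≠ j → ¬ D.graph.Adj j i → M i j = 0) ∧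
    (∀ x y : V ⊕ D.Edge, D.colour x = D.colour y →
      M (D.position x).1 (D.position x).2 = M (D.position y).1 (D.position y).2)}
  add_mem' {M N} hM hN := by
    refine ⟨fun i j h h' => ?_, fun x y h => ?_⟩
    · simp [hM.1 i j h h', hN.1 i j h h']
    · simp [hM.2 x y h, hN.2 x y h]
  zero_mem' := by simp
  smul_mem' c M hM := by
    refine ⟨fun i j h h' => ?_, fun x y h => ?_⟩
    · simp [hM.1 i j h h']
    · simp [hM.2 x y h]

variable {D}

theorem coeffSpace_diag {M : Matrix V V ℝ} (hM : M ∈ D.coeffSpace) {i j : V}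
    (h : D.vertexColour i = D.vertexColour j) : M i i = M j j :=
  hM.2 (Sum.inl i) (Sum.inl j) h

theorem coeffSpace_edge {M : Matrix V V ℝ} (hM : M ∈ D.coeffSpace) {e e' : D.Edge}
    (h : D.edgeColour e = D.edgeColour e') : M e.1.2 e.1.1 = M e'.1.2 e'.1.1 :=
  hM.2 (Sum.inr e) (Sum.inr e') h

theorem Compatible.mem_coeffSpace (hD : D.Compatible) {M : Matrix V V ℝ}
    (h0 : ∀ i j, i ≠ j → ¬ D.graph.Adj j i → M i j = 0)
    (hv : ∀ i j, D.vertexColour i = D.vertexColour j → M i i = M j j)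
    (he : ∀ e e' : D.Edge, D.edgeColour e = D.edgeColour e' →
      M e.1.2 e.1.1 = M e'.1.2 e'.1.1) : M ∈ D.coeffSpace := by
  refine ⟨h0, ?_⟩
  rintro (i | e) (j | e') h
  · exact hv i j h
  · exact absurd h (hD.1 i e')
  · exact absurd h.symm (hD.1 j e)
  · exact he e e' h

theorem not_adj_self (D : ColouredDAG V C) (i : V) : ¬ D.graph.Adj i i :=
  fun h => D.acyclic i (.single h)

/-- Counting ancestors works: along `i → j` all ancestors of `i` are kept and, by acyclicity, `i` is
a new one. -/
theorem exists_height [Fintype V] (D : ColouredDAG V C) :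
    ∃ f : V → ℕ, ∀ i j, D.graph.Adj i j → f i < f j := by
  classical
  refine ⟨fun i => (Finset.univ.filter fun k => Relation.TransGen D.graph.Adj k i).card,
    fun i j h => Finset.card_lt_card ?_⟩
  rw [Finset.ssubset_iff_of_subset]
  · exact ⟨i, by simpa using .single h, by simpa using D.acyclic i⟩
  · intro k hk
    simp only [Finset.mem_filter, Finset.mem_univ, true_and] at hk ⊢
    exact hk.tail h

theorem Compatible.one_mem [DecidableEq V] (hD : D.Compatible) : (1 : Matrix V V ℝ) ∈ D.coeffSpace := by
  refine hD.mem_coeffSpace (fun i j h _ => one_apply_ne h) (fun i j _ => by simp) ?_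
  intro e e' _
  have hne : ∀ e : D.Edge, e.1.2 ≠ e.1.1 := fun e h =>
    D.not_adj_self e.1.1 (by simpa only [h] using e.2)
  rw [one_apply_ne (hne e), one_apply_ne (hne e')]

variable [Fintype V] [DecidableEq V]

theorem mem_matrixSet {a : GL V ℝ} :
    a ∈ D.matrixSet ↔ (a : Matrix V V ℝ) ∈ D.coeffSpace := Iff.rfl

/-- A nonzero term of a permutation `σ ≠ 1` would strictly raise the height at each moved vertex,
but permuting vertices preserves the sum of heights. -/
theorem det_eq_prod_diag {M : Matrix V V ℝ} (hM : M ∈ D.coeffSpace) :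
    M.det = ∏ i, M i i := by
  obtain ⟨f, hf⟩ := D.exists_height
  rw [det_apply, Finset.sum_eq_single 1]
  · simp
  · intro σ _ hσ
    by_contra hne
    have hprod : ∏ i, M (σ i) i ≠ 0 := fun h => hne (by rw [h, smul_zero])
    have hadj : ∀ i, σ i ≠ i → f i < f (σ i) := fun i hi => by
      by_contra hlt
      exact Finset.prod_ne_zero_iff.1 hprod i (Finset.mem_univ i)
        (hM.1 _ _ hi fun h => hlt (hf _ _ h))
    have hle : ∀ i ∈ Finset.univ, f i ≤ f (σ i) := fun i _ => by
      by_cases hi : σ i = i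
      · rw [hi]
      · exact (hadj i hi).le
    have heq := (Finset.sum_eq_sum_iff_of_le hle).1 (Equiv.sum_comp σ f).symm
    refine hσ (Equiv.ext fun i => ?_)
    by_contra hi
    exact (hadj i hi).ne (heq i (Finset.mem_univ i))
  · simp

theorem diag_ne_zero {M : Matrix V V ℝ} (hM : M ∈ D.coeffSpace) (hdet : M.det ≠ 0) (i : V) :
    M i i ≠ 0 := by
  rw [det_eq_prod_diag hM] at hdet
  exact Finset.prod_ne_zero_iff.1 hdet i (Finset.mem_univ i)

theorem det_pos_of_diag_pos {M : Matrix V V ℝ} (hM : M ∈ D.coeffSpace) (hpos : ∀ i, 0 < M i i) :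
    0 < M.det := by
  rw [det_eq_prod_diag hM]
  exact Finset.prod_pos fun i _ => hpos i

/-- The entry of an edge is scaled by the factor of its target; edges of one colour have targets of
one colour. -/
theorem Compatible.diagonal_mul_mem (hD : D.Compatible) {M : Matrix V V ℝ}
    (hM : M ∈ D.coeffSpace) {d : V → ℝ}
    (hd : ∀ i j, D.vertexColour i = D.vertexColour j → d i = d j) :
    diagonal d * M ∈ D.coeffSpace := by
  refine hD.mem_coeffSpace (fun i j h h' => ?_) (fun i j h => ?_) (fun e e' h => ?_)
  · rw [diagonal_mul, hM.1 i j h h', mul_zero]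
  · rw [diagonal_mul, diagonal_mul, hd i j h, coeffSpace_diag hM h]
  · rw [diagonal_mul, diagonal_mul, hd _ _ (hD.2 e e' h), coeffSpace_edge hM h]

/-- With `Δ` the diagonal part of `M`, write `M = Δ(1 - Λ)`, so `Λ = 1 - Δ⁻¹M` and `Ω = Δ⁻²`. -/
theorem Compatible.transpose_mul_self_mem_model (hD : D.Compatible) {M : Matrix V V ℝ}
    (hM : M ∈ D.coeffSpace) (hdet : M.det ≠ 0) : Mᵀ * M ∈ D.model := by
  have hne := diag_ne_zero hM hdet
  have hmem := D.coeffSpace.sub_mem hD.one_mem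
    (hD.diagonal_mul_mem hM (d := fun i => (M i i)⁻¹) fun i j h => by rw [coeffSpace_diag hM h])
  refine ⟨1 - diagonal (fun i => (M i i)⁻¹) * M, fun i => ((M i i) ^ 2)⁻¹, fun i j h => ?_,
    fun e e' h => coeffSpace_edge hmem h, fun i => ?_, fun i j h => ?_, ?_⟩
  · by_cases hij : i = j
    · subst hij
      simp [hne i]
    · exact hmem.1 i j hij h
  · have := hne i
    positivity
  · show ((M i i) ^ 2)⁻¹ = ((M j j) ^ 2)⁻¹
    rw [coeffSpace_diag hM h]
  · have hinv : (diagonal fun i => ((M i i) ^ 2)⁻¹)⁻¹ = diagonal fun i => (M i i) ^ 2 := by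
      refine inv_eq_left_inv ?_
      rw [diagonal_mul_diagonal, ← diagonal_one]
      congr 1
      funext i
      exact mul_inv_cancel₀ (pow_ne_zero 2 (hne i))
    have hone : diagonal (fun i => (M i i)⁻¹) *
        (diagonal (fun i => (M i i) ^ 2) * diagonal (fun i => (M i i)⁻¹)) = 1 := by
      rw [diagonal_mul_diagonal, diagonal_mul_diagonal, ← diagonal_one]
      congr 1
      funext i
      have := hne i
      field_simp
    rw [hinv, sub_sub_cancel, transpose_mul, diagonal_transpose]
    calc Mᵀ * M = Mᵀ * (diagonal (fun i => (M i i)⁻¹) *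
          (diagonal (fun i => (M i i) ^ 2) * diagonal (fun i => (M i i)⁻¹))) * M := by
          rw [hone, Matrix.mul_one]
      _ = _ := by simp only [Matrix.mul_assoc]

/-- The factor is `Ω^(-1/2)(1 - Λ)`, whose diagonal is positive because `Λ` has zero diagonal. -/
theorem Compatible.exists_of_mem_model (hD : D.Compatible) {Ψ : Matrix V V ℝ}
    (hΨ : Ψ ∈ D.model) : ∃ M ∈ D.coeffSpace, (∀ i, 0 < M i i) ∧ Ψ = Mᵀ * M := by
  obtain ⟨Λ, ω, h0, he, hpos, hω, rfl⟩ := hΨ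
  have hΛ : Λ ∈ D.coeffSpace := hD.mem_coeffSpace (fun i j _ h => h0 i j h)
    (fun i j _ => by rw [h0 i i (D.not_adj_self i), h0 j j (D.not_adj_self j)]) he
  refine ⟨diagonal (fun i => (√(ω i))⁻¹) * (1 - Λ),
    hD.diagonal_mul_mem (D.coeffSpace.sub_mem hD.one_mem hΛ) fun i j h => by rw [hω i j h],
    fun i => ?_, ?_⟩
  · simpa [h0 i i (D.not_adj_self i)] using hpos i
  · have hinv : (diagonal ω)⁻¹ = diagonal fun i => (√(ω i))⁻¹ * (√(ω i))⁻¹ := by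
      refine inv_eq_left_inv ?_
      rw [diagonal_mul_diagonal, ← diagonal_one]
      congr 1
      funext i
      rw [← mul_inv, Real.mul_self_sqrt (hpos i).le, inv_mul_cancel₀ (hpos i).ne']
    rw [hinv, ← diagonal_mul_diagonal, transpose_mul, diagonal_transpose]
    simp only [Matrix.mul_assoc]

theorem Compatible.exists_pos_diag (hD : D.Compatible) {M : Matrix V V ℝ}
    (hM : M ∈ D.coeffSpace) (hdet : M.det ≠ 0) :
    ∃ N ∈ D.coeffSpace, (∀ i, 0 < N i i) ∧ Nᵀ * N = Mᵀ * M := by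
  obtain ⟨N, hN, hpos, h⟩ := hD.exists_of_mem_model (hD.transpose_mul_self_mem_model hM hdet)
  exact ⟨N, hN, hpos, h.symm⟩

end ColouredDAG

/-! ### The likelihood in terms of a factor -/

section Likelihood

variable {V : Type*} [Fintype V] [DecidableEq V] {n : ℕ}

/-- Singular `M` is included: both sides are then `0`, as the inverse of `0` is `0`. -/
theorem gaussianDensity_transpose_mul_self (M : Matrix V V ℝ) (y : V → ℝ) :
    gaussianDensity (Mᵀ * M) y = (√((2 * Real.pi) ^ Fintype.card V))⁻¹ * |M.det| *
      Real.exp (-(1 / 2) * ∑ i, (M *ᵥ y) i ^ 2) := by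
  have hquad : y ⬝ᵥ ((Mᵀ * M) *ᵥ y) = ∑ i, (M *ᵥ y) i ^ 2 := by
    rw [← mulVec_mulVec, dotProduct_mulVec, vecMul_transpose]
    simp only [dotProduct, sq]
  have hdet : 1 / √(((2 * Real.pi) • (Mᵀ * M)⁻¹).det) =
      (√((2 * Real.pi) ^ Fintype.card V))⁻¹ * |M.det| := by
    rw [det_smul, det_nonsing_inv, det_mul, det_transpose, Ring.inverse_eq_inv',
      Real.sqrt_mul (by positivity), Real.sqrt_inv, Real.sqrt_mul_self_eq_abs, one_div, mul_inv,
      inv_inv]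
  rw [gaussianDensity, hdet, hquad]

theorem likelihood_transpose_mul_self (Y : Matrix V (Fin n) ℝ) (M : Matrix V V ℝ) :
    likelihood Y (Mᵀ * M) = (√((2 * Real.pi) ^ Fintype.card V))⁻¹ ^ n * |M.det| ^ n *
      Real.exp (-(1 / 2) * ∑ k, ∑ i, (M * Y) i k ^ 2) := by
  simp only [likelihood, gaussianDensity_transpose_mul_self, Finset.prod_mul_distrib,
    Finset.prod_const, Finset.card_univ, Fintype.card_fin, ← Real.exp_sum, ← Finset.mul_sum]
  rfl

theorem likelihood_le_iff (Y : Matrix V (Fin n) ℝ) (M N : Matrix V V ℝ) :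
    likelihood Y (Mᵀ * M) ≤ likelihood Y (Nᵀ * N) ↔
      |M.det| ^ n * Real.exp (-(1 / 2) * ∑ k, ∑ i, (M * Y) i k ^ 2) ≤
        |N.det| ^ n * Real.exp (-(1 / 2) * ∑ k, ∑ i, (N * Y) i k ^ 2) := by
  rw [likelihood_transpose_mul_self, likelihood_transpose_mul_self, mul_assoc, mul_assoc]
  exact mul_le_mul_iff_right₀ (by positivity)

end Likelihood

/-! ### Comparison of maximisers -/

namespace ColouredDAG

variable {V C : Type*} [Fintype V] [DecidableEq V] {D : ColouredDAG V C} {n : ℕ}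
  {Y : Matrix V (Fin n) ℝ}

/-- The likelihood is log-concave in the factor `M`, strictly so in `M * Y`. -/
theorem Compatible.mul_eq_mul_of_mem_mleSet (hD : D.Compatible) {M N : Matrix V V ℝ}
    (hM : M ∈ D.coeffSpace) (hN : N ∈ D.coeffSpace) (hMpos : ∀ i, 0 < M i i)
    (hNpos : ∀ i, 0 < N i i) (hMle : Mᵀ * M ∈ mleSet D.model Y)
    (hNle : Nᵀ * N ∈ mleSet D.model Y) : M * Y = N * Y := by
  set P : Matrix V V ℝ := (1 / 2 : ℝ) • (M + N) with hPdef
  have hP : P ∈ D.coeffSpace := D.coeffSpace.smul_mem _ (D.coeffSpace.add_mem hM hN)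
  have hPpos : ∀ i, 0 < P i i := fun i => by
    have h1 := hMpos i
    have h2 := hNpos i
    simp only [hPdef, Matrix.smul_apply, Matrix.add_apply, smul_eq_mul]
    positivity
  have hMdet := det_pos_of_diag_pos hM hMpos
  have hNdet := det_pos_of_diag_pos hN hNpos
  have hPdet := det_pos_of_diag_pos hP hPpos
  have hPmod := hD.transpose_mul_self_mem_model hP hPdet.ne'
  have h1 := (likelihood_le_iff Y P M).1 (hMle.2 _ hPmod)
  have h2 := (likelihood_le_iff Y P N).1 (hNle.2 _ hPmod)
  rw [abs_of_pos hPdet, abs_of_pos hMdet] at h1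
  rw [abs_of_pos hPdet, abs_of_pos hNdet] at h2
  -- The inequality of arithmetic and geometric means, applied to each diagonal entry.
  have hdet : M.det * N.det ≤ P.det * P.det := by
    rw [det_eq_prod_diag hM, det_eq_prod_diag hN, det_eq_prod_diag hP, ← Finset.prod_mul_distrib,
      ← Finset.prod_mul_distrib]
    refine Finset.prod_le_prod (fun i _ => (mul_pos (hMpos i) (hNpos i)).le) fun i _ => ?_
    simp only [hPdef, Matrix.smul_apply, Matrix.add_apply, smul_eq_mul]
    nlinarith [sq_nonneg (M i i - N i i)]
  set SM := ∑ k, ∑ i, (M * Y) i k ^ 2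
  set SN := ∑ k, ∑ i, (N * Y) i k ^ 2
  set SP := ∑ k, ∑ i, (P * Y) i k ^ 2
  set S := ∑ k, ∑ i, ((M * Y) i k - (N * Y) i k) ^ 2
  -- The parallelogram identity; multiplying the two comparisons with the midpoint `P` will force `S
  -- ≤ 0`.
  have hsum : SM + SN = 2 * SP + S / 2 := by
    simp only [SM, SN, SP, S, Finset.mul_sum, Finset.sum_div, ← Finset.sum_add_distrib]
    refine Finset.sum_congr rfl fun k _ => Finset.sum_congr rfl fun i _ => ?_
    simp only [hPdef, smul_mul, Matrix.add_mul, Matrix.smul_apply, Matrix.add_apply, smul_eq_mul]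
    ring
  have h3 := mul_le_mul h1 h2 (by positivity) (by positivity)
  have h4 : (P.det * P.det) ^ n * Real.exp (-SP) ≤
      (P.det * P.det) ^ n * Real.exp (-(1 / 2) * (SM + SN)) := by
    calc (P.det * P.det) ^ n * Real.exp (-SP)
        = P.det ^ n * Real.exp (-(1 / 2) * SP) * (P.det ^ n * Real.exp (-(1 / 2) * SP)) := by
          rw [mul_pow, mul_mul_mul_comm, ← Real.exp_add]
          ring_nf
      _ ≤ _ := h3
      _ = (M.det * N.det) ^ n * Real.exp (-(1 / 2) * (SM + SN)) := by
          rw [mul_pow, mul_mul_mul_comm, ← Real.exp_add, mul_add]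
      _ ≤ _ := by gcongr
  have h5 := Real.exp_le_exp.1 (le_of_mul_le_mul_left h4 (by positivity))
  have hS0 : S = 0 := le_antisymm (by linarith)
    (Finset.sum_nonneg fun k _ => Finset.sum_nonneg fun i _ => sq_nonneg _)
  ext i k
  have h6 := (Finset.sum_eq_zero_iff_of_nonneg
    (fun k _ => Finset.sum_nonneg fun i _ => sq_nonneg _)).1 hS0 k (Finset.mem_univ k)
  have h7 := (Finset.sum_eq_zero_iff_of_nonneg (fun i _ => sq_nonneg _)).1 h6 i (Finset.mem_univ i)
  exact sub_eq_zero.1 (pow_eq_zero_iff two_ne_zero |>.1 h7)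

theorem Compatible.det_eq_det_of_mem_mleSet (hD : D.Compatible) (hn : n ≠ 0) {M N : Matrix V V ℝ}
    (hM : M ∈ D.coeffSpace) (hN : N ∈ D.coeffSpace) (hMpos : ∀ i, 0 < M i i)
    (hNpos : ∀ i, 0 < N i i) (hMle : Mᵀ * M ∈ mleSet D.model Y)
    (hNle : Nᵀ * N ∈ mleSet D.model Y) : M.det = N.det := by
  have h1 := (likelihood_le_iff Y M N).1 (hNle.2 _ hMle.1)
  have h2 := (likelihood_le_iff Y N M).1 (hMle.2 _ hNle.1)
  have hMdet := det_pos_of_diag_pos hM hMpos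
  have hNdet := det_pos_of_diag_pos hN hNpos
  rw [hD.mul_eq_mul_of_mem_mleSet hM hN hMpos hNpos hMle hNle, abs_of_pos hMdet,
    abs_of_pos hNdet] at h1 h2
  exact (pow_left_inj₀ hMdet.le hNdet.le hn).1
    (le_antisymm (le_of_mul_le_mul_right h1 (Real.exp_pos _))
      (le_of_mul_le_mul_right h2 (Real.exp_pos _)))

/-- At a maximiser `Mᵀ * M` of the likelihood no scaling of the rows of `M` by factors that are
constant on vertex colours fixes `M * Y` and increases the determinant. -/
theorem Compatible.scaling_eq_one_of_mem_mleSet (hD : D.Compatible) (hn : n ≠ 0)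
    {M : Matrix V V ℝ} (hM : M ∈ D.coeffSpace) (hdet : M.det ≠ 0)
    (hMle : Mᵀ * M ∈ mleSet D.model Y) {d : V → ℝ}
    (hd : ∀ i j, D.vertexColour i = D.vertexColour j → d i = d j) (hd1 : ∀ i, 1 ≤ d i)
    (hfix : diagonal d * (M * Y) = M * Y) (i : V) : d i = 1 := by
  have hprod : 0 < ∏ i, d i := Finset.prod_pos fun i _ => one_pos.trans_le (hd1 i)
  have hdet' : (diagonal d * M).det = (∏ i, d i) * M.det := by rw [det_mul, det_diagonal]
  have h := (likelihood_le_iff Y (diagonal d * M) M).1 (hMle.2 _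
    (hD.transpose_mul_self_mem_model (hD.diagonal_mul_mem hM hd)
      (by rw [hdet']; exact mul_ne_zero hprod.ne' hdet)))
  rw [Matrix.mul_assoc, hfix, hdet', abs_mul, abs_of_pos hprod] at h
  have h1 := le_of_mul_le_mul_right h (Real.exp_pos _)
  have h2 := (pow_le_pow_iff_left₀ (by positivity) (by positivity) hn).1 h1
  have h3 : ∏ i, d i ≤ 1 := by
    by_contra! hlt
    have := abs_pos.2 hdet
    nlinarith
  have h4 : d i ≤ ∏ j, d j := by
    rw [← Finset.mul_prod_erase _ _ (Finset.mem_univ i)]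
    exact le_mul_of_one_le_right (zero_le_one.trans (hd1 i)) (Finset.prod_const_one.symm.le.trans
      (Finset.prod_le_prod (fun _ _ => zero_le_one) fun j _ => hd1 j))
  exact le_antisymm (h4.trans h3) (hd1 i)

/-- An orthogonal matrix in a group of matrices supported on an acyclic graph is diagonal. -/
theorem orthogonal_eq_diagonal {k : GL V ℝ} (hk : k ∈ D.matrixSet) (hk' : k⁻¹ ∈ D.matrixSet)
    (horth : (k : Matrix V V ℝ)ᵀ * (k : Matrix V V ℝ) = 1) :
    (k : Matrix V V ℝ) = diagonal fun i => (k : Matrix V V ℝ) i i := by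
  have hinv : ((k⁻¹ : GL V ℝ) : Matrix V V ℝ) = (k : Matrix V V ℝ)ᵀ := by
    rw [coe_units_inv, inv_eq_left_inv horth]
  ext i j
  by_cases hij : i = j
  · subst hij
    simp
  rw [diagonal_apply_ne _ hij]
  by_contra hne
  -- A nonzero off-diagonal entry of `k` is also the transposed entry of `k⁻¹ = kᵀ`, which gives a
  -- 2-cycle.
  have h1 : D.graph.Adj j i := by
    by_contra h
    exact hne (hk.1 i j hij h)
  have h2 : D.graph.Adj i j := by
    by_contra h
    have := hk'.1 j i (Ne.symm hij) h
    rw [hinv] at this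
    exact hne this
  exact D.acyclic i (.tail (.single h2) h1)

end ColouredDAG

/-! ### The bijection -/

theorem propositionB5 {V : Type*} [Fintype V] [DecidableEq V] {C : Type*} (D : ColouredDAG V C)
    (hcompat : D.Compatible) (hgroup : IsMatrixGroup D.matrixSet)
    {n : ℕ} (Y : Matrix V (Fin n) ℝ) (hY : IsPolystable (slPart D.matrixSet) Y)
    (a : GL V ℝ) (ha : a ∈ slPart D.matrixSet) (lam : ℝ) (hlam : 0 < lam)
    (hmle : lam • ((a : Matrix V V ℝ)ᵀ * (a : Matrix V V ℝ)) ∈ mleSet D.model Y) :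
    Set.BijOn
      (fun g : GL V ℝ => lam • ((g : Matrix V V ℝ)ᵀ * (a : Matrix V V ℝ)ᵀ *
        (a : Matrix V V ℝ) * (g : Matrix V V ℝ)))
      (setStabiliser (slPart D.matrixSet) Y) (mleSet D.model Y) := by

  obtain ⟨H, hH⟩ := hgroup
  have hmem : ∀ g : GL V ℝ, g ∈ H ↔ g ∈ D.matrixSet := fun g => by rw [← hH]; rfl
  -- With no samples the likelihood would be constant; `Y ≠ 0` excludes this.
  have hn : n ≠ 0 := by
    rintro rfl
    exact hY.1 (by ext i k; exact k.elim0)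
  have hsqrt : √lam * √lam = lam := Real.mul_self_sqrt hlam.le
  have hsqrt0 : √lam ≠ 0 := (Real.sqrt_pos.2 hlam).ne'
  have hform : ∀ g : GL V ℝ, lam • ((g : Matrix V V ℝ)ᵀ * (a : Matrix V V ℝ)ᵀ *
      (a : Matrix V V ℝ) * (g : Matrix V V ℝ)) =
      (√lam • ((a * g : GL V ℝ) : Matrix V V ℝ))ᵀ * (√lam • ((a * g : GL V ℝ) : Matrix V V ℝ)) := by
    intro g
    rw [transpose_smul, smul_mul, Matrix.mul_smul, smul_smul, hsqrt, Units.val_mul, transpose_mul]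
    simp only [Matrix.mul_assoc]
  have hform1 : lam • ((a : Matrix V V ℝ)ᵀ * (a : Matrix V V ℝ)) =
      (√lam • (a : Matrix V V ℝ))ᵀ * (√lam • (a : Matrix V V ℝ)) := by
    rw [transpose_smul, smul_mul, Matrix.mul_smul, smul_smul, hsqrt]
  have hdetne : ∀ g : GL V ℝ, (√lam • (g : Matrix V V ℝ)).det ≠ 0 := fun g => by
    rw [det_smul]
    exact mul_ne_zero (pow_ne_zero _ hsqrt0) (GeneralLinearGroup.det_ne_zero g)
  have hspace : ∀ g ∈ D.matrixSet, √lam • (g : Matrix V V ℝ) ∈ D.coeffSpace :=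
    fun g hg => D.coeffSpace.smul_mem _ hg
  rw [hform1] at hmle
  refine ⟨?_, ?_, ?_⟩
  · rintro g ⟨⟨hg, hgdet⟩, hgY⟩
    have hag : a * g ∈ D.matrixSet :=
      (hmem _).1 (H.mul_mem ((hmem _).2 ha.1) ((hmem _).2 hg))
    show lam • _ ∈ _
    rw [hform]
    refine ⟨hcompat.transpose_mul_self_mem_model (hspace _ hag) (hdetne _), fun Ψ hΨ => ?_⟩
    refine (hmle.2 Ψ hΨ).trans (le_of_eq ?_)
    rw [likelihood_transpose_mul_self, likelihood_transpose_mul_self, det_smul, det_smul,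
      Units.val_mul, det_mul, hgdet, mul_one, smul_mul, smul_mul, Matrix.mul_assoc, hgY]
  · rintro g ⟨⟨hg, hgdet⟩, hgY⟩ h ⟨⟨hh, hhdet⟩, hhY⟩ heq
    have heq' := smul_right_injective _ hlam.ne' heq
    set k : GL V ℝ := a * g * (a * h)⁻¹ with hkdef
    have hkH : k ∈ H := H.mul_mem (H.mul_mem ((hmem _).2 ha.1) ((hmem _).2 hg))
      (H.inv_mem (H.mul_mem ((hmem _).2 ha.1) ((hmem _).2 hh)))
    have hkah : k * (a * h) = a * g := by rw [hkdef, inv_mul_cancel_right]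
    have hkah' : (k : Matrix V V ℝ) * ((a * h : GL V ℝ) : Matrix V V ℝ) =
        ((a * g : GL V ℝ) : Matrix V V ℝ) := by rw [← Units.val_mul, hkah]
    have hgram : ((a * g : GL V ℝ) : Matrix V V ℝ)ᵀ * ((a * g : GL V ℝ) : Matrix V V ℝ) =
        ((a * h : GL V ℝ) : Matrix V V ℝ)ᵀ * ((a * h : GL V ℝ) : Matrix V V ℝ) := by
      simpa only [Units.val_mul, transpose_mul, Matrix.mul_assoc] using heq'
    have horth : (k : Matrix V V ℝ)ᵀ * (k : Matrix V V ℝ) = 1 := by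
      set B : Matrix V V ℝ := ((a * h : GL V ℝ) : Matrix V V ℝ)
      have hB : IsUnit B := (a * h).isUnit
      have hBt : IsUnit Bᵀ := (isUnit_transpose B).2 hB
      rw [← hkah', transpose_mul] at hgram
      refine hBt.mul_left_cancel (hB.mul_right_cancel ?_)
      rw [Matrix.mul_one, ← hgram]
      simp only [Matrix.mul_assoc]
    have hdiag := ColouredDAG.orthogonal_eq_diagonal ((hmem _).1 hkH)
      ((hmem _).1 (H.inv_mem hkH)) horth
    have hkaY : (k : Matrix V V ℝ) * ((a : Matrix V V ℝ) * Y) = (a : Matrix V V ℝ) * Y := by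
      conv_lhs => rw [← hhY]
      conv_rhs => rw [← hgY]
      rw [← Matrix.mul_assoc (a : Matrix V V ℝ), ← Matrix.mul_assoc (a : Matrix V V ℝ),
        ← Units.val_mul, ← Units.val_mul, ← Matrix.mul_assoc, hkah']
    have hk1 : ∀ i, (k : Matrix V V ℝ) i i = 1 := by
      intro i
      by_contra hi
      -- Doubling exactly the rows with `k j j ≠ 1` respects vertex colours and fixes `a * Y`, where
      -- these rows vanish.
      have := hcompat.scaling_eq_one_of_mem_mleSet hn (hspace _ ha.1) (hdetne a) hmle
        (d := fun j => if (k : Matrix V V ℝ) j j = 1 then 1 else 2)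
        (fun p q hpq => by
          rw [ColouredDAG.coeffSpace_diag (ColouredDAG.mem_matrixSet.1 ((hmem _).1 hkH)) hpq])
        (fun j => by split_ifs <;> norm_num)
        (by
          ext j l
          rw [diagonal_mul]
          split_ifs with hj
          · rw [one_mul]
          · have h1 := congrFun (congrFun hkaY j) l
            rw [hdiag, diagonal_mul] at h1
            have h2 : ((a : Matrix V V ℝ) * Y) j l = 0 := by
              have h3 : ((k : Matrix V V ℝ) j j - 1) * ((a : Matrix V V ℝ) * Y) j l = 0 := by
                linarith
              exact (mul_eq_zero.1 h3).resolve_left (sub_ne_zero.2 hj)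
            rw [smul_mul, Matrix.smul_apply, h2, smul_zero, mul_zero]) i
      simp [hi] at this
    have hkone : k = 1 := by
      refine Units.ext ?_
      rw [hdiag]
      simp [hk1]
    rw [hkone, one_mul] at hkah
    exact (mul_left_cancel hkah).symm
  · intro Ψ hΨ
    obtain ⟨b, hb, hbpos, rfl⟩ := hcompat.exists_of_mem_model hΨ.1
    -- Log-concavity needs positive diagonals, so `√lam • a` is replaced by a factor `a₀` with the
    -- same Gram matrix; the preimage is `a₀⁻¹ * b`.
    obtain ⟨a₀, ha₀, ha₀pos, ha₀eq⟩ := hcompat.exists_pos_diag (hspace _ ha.1) (hdetne a)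
    rw [← ha₀eq] at hmle
    have hmulY := hcompat.mul_eq_mul_of_mem_mleSet ha₀ hb ha₀pos hbpos hmle hΨ
    have hdet := hcompat.det_eq_det_of_mem_mleSet hn ha₀ hb ha₀pos hbpos hmle hΨ
    have ha₀det := (ColouredDAG.det_pos_of_diag_pos ha₀ ha₀pos).ne'
    have hbdet := (ColouredDAG.det_pos_of_diag_pos hb hbpos).ne'
    let a' : GL V ℝ := GeneralLinearGroup.mkOfDetNeZero a₀ ha₀det
    let b' : GL V ℝ := GeneralLinearGroup.mkOfDetNeZero b hbdet
    have ha' : (a' : Matrix V V ℝ) = a₀ := rfl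
    have hb' : (b' : Matrix V V ℝ) = b := rfl
    have hmul : a₀ * ((a'⁻¹ * b' : GL V ℝ) : Matrix V V ℝ) = b := by
      rw [← ha', ← Units.val_mul, mul_inv_cancel_left, hb']
    refine ⟨a'⁻¹ * b', ⟨⟨(hmem _).1 (H.mul_mem (H.inv_mem ((hmem a').2 ha₀)) ((hmem b').2 hb)),
      ?_⟩, ?_⟩, ?_⟩
    · have := congrArg Matrix.det hmul
      rw [det_mul, ← hdet] at this
      exact mul_left_cancel₀ ha₀det (this.trans (mul_one _).symm)
    · rw [Units.val_mul, Matrix.mul_assoc, hb', ← hmulY, ← ha', ← Matrix.mul_assoc, ← Units.val_mul,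
        inv_mul_cancel, Units.val_one, Matrix.one_mul]
    · show lam • _ = _
      rw [Matrix.mul_assoc _ _ (a : Matrix V V ℝ), ← Matrix.smul_mul, ← Matrix.mul_smul, hform1,
        ← ha₀eq, ← Matrix.mul_assoc, Matrix.mul_assoc, hmul, ← transpose_mul, hmul]
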